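/- Let $\mathcal S,\mathcal A$ be finite nonempty sets and $H\ge 1$. Let $P^o_{h,s,a}\in\Delta(\mathcal S)$ be nominal transition probabilities and $r_h(s,a)\in[0,1]$ known rewards, for $h\in\{1,\dots,H\}$, $s\in\mathcal S$, $a\in\mathcal A$. For $\rho>0$ and $Q\in\Delta(\mathcal S)$ let $\mathcal B_\rho(Q)=\{P\in\Delta(\mathcal S): D_{\mathrm{KL}}(P,Q)\le\rho\}$, where $D_{\mathrm{KL}}(P,Q)=\sum_{s'}P(s')\log\frac{P(s')}{Q(s')}$ ($=+\infty$ if $P\not\ll Q$), and let $L_{Q}V=\inf\{\sum_{s'}P(s')V(s'):P\in\mathcal B_\rho(Q)\}$ for $V\in\mathbb R^{\mathcal S}$. For a deterministic Markov policy $\pi=(\pi_h)_{h=1}^H$, $\pi_h:\mathcal S\to\mathcal A$, let $V^{\pi,P}(s)$ be the expectation of $\sum_{t=1}^H r_t(s_t,\pi_t(s_t))$ for $s_1=s$, $s_{t+1}\sim P_{t,s_t,\pi_t(s_t)}$. Let $V^\pi(s)=\inf_P V^{\pi,P}(s)$, the infimum over all $P=(P_{h,s,a})$ with $P_{h,s,a}\in\mathcal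 B_\rho(P^o_{h,s,a})$ for every $(h,s,a)$, and $V^*(s)=\sup_\pi V^\pi(s)$. Let $p_{\min}=\min\{P^o_{h,s,a}(s') : P^o_{h,s,a}(s')>0\}$. Robust Phased Value Learning (RPVL) draws, for each $(h,s,a)$, $N$ samples from $P^o_{h,s,a}$, all samples being independent, so that $N_{\mathrm{total}}=N|\mathcal S||\mathcal A|H$. It forms the empirical frequencies $\widehat P_{h,s,a}$, sets $\widehat V_{H+1}=0$ and, for $h=H,\dots,1$, $$\widehat V_h(s)=\max_a\{r_h(s,a)+L_{\widehat P_{h,s,a}}\widehat V_{h+1}\},\qquad \hat\pi_h(s)\in\operatorname*{arg\,max}_a\{r_h(s,a)+L_{\widehat P_{h,s,a}}\widehat V_{h+1}\},$$ and outputs $\hat\pi$ (ties broken arbitrarily). Let $\delta\in(0,1)$, $\rho>0$, $\varepsilon\in(0,H)$. If $$N_{\mathrm{total}}\ \ge\ \frac{2H^5|\mathcal S||\mathcal A|}{\rho^2p_{\min}^2\varepsilon^2}\log\frac{2H|\mathcal S|^2|\mathcal A|}{\delta}$$ and $N$ is also at least the problem-dependent constant, independent of $\varepsilon$, $\frac1{p_{\min}^2}\log\frac{2H|\mathcal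 S|^2|\mathcal A|}{\delta}$ (a condition that is implied by the first one whenever $\rho\varepsilon\le\sqrt2\,H^2$, in particular whenever $\rho\le H$), then, with probability at least $1-\delta$, $\|V^*-V^{\hat\pi}\|_\infty\le\varepsilon$. -/

import Mathlib

open scoped BigOperators

noncomputable section

namespace RobustMDP

/-- Data of a tabular finite-horizon problem with horizon `H`: a nominal transition model and a
deterministic reward with values in `[0,1]`. Times `1, …, H` are represented by `Fin H`;
`trans h s a s'` is the nominal probability of moving from `s` to `s'` under action `a` at
time `h`. -/
structure NominalMDP (S A : Type*) [Fintype S] (H : ℕ) where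
  trans : Fin H → S → A → S → ℝ
  trans_mem : ∀ h s a, trans h s a ∈ stdSimplex ℝ S
  reward : Fin H → S → A → ℝ
  reward_mem : ∀ h s a, reward h s a ∈ Set.Icc (0 : ℝ) 1

/-- Deterministic non-stationary Markov policies. -/
abbrev Policy (S A : Type*) (H : ℕ) := Fin H → S → A

section Divergence

variable {S : Type*} [Fintype S]

open Classical in
/-- Kullback-Leibler divergence `∑ P log (P / Q)` of two probability vectors, with the usual
conventions `0 log (0 / q) = 0` and `p log (p / 0) = +∞` for `p > 0`. -/
def klDist (P Q : S → ℝ) : EReal :=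
  if ∀ s, Q s = 0 → P s = 0 then ((∑ s, P s * Real.log (P s / Q s) : ℝ) : EReal) else ⊤

/-- The KL ball of radius `ρ` around `Q` in the probability simplex. -/
def klBall (ρ : ℝ) (Q : S → ℝ) : Set (S → ℝ) :=
  {P | P ∈ stdSimplex ℝ S ∧ klDist P Q ≤ (ρ : EReal)}

/-- The worst-case expectation `inf {P V : P in the KL ball of radius ρ around Q}`. -/
def worstExp (ρ : ℝ) (Q V : S → ℝ) : ℝ :=
  sInf ((fun P : S → ℝ => ∑ s, P s * V s) '' klBall ρ Q)

end Divergence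

section Values

variable {S A : Type*} [Fintype S] {H : ℕ}

open Classical in
/-- Probability of the trajectory `x = (s_1, …, s_{H+1})` when the initial state is `s₀`, the
policy is `π`, and `s_{t+1}` is drawn from `P t s_t (π t s_t)`. -/
def pathProb (P : Fin H → S → A → S → ℝ) (π : Policy S A H) (s₀ : S) (x : Fin (H + 1) → S) : ℝ :=
  (if x 0 = s₀ then 1 else 0) *
    ∏ t : Fin H, P t (x t.castSucc) (π t (x t.castSucc)) (x t.succ)

open Classical in
/-- Value `V^{π,P}(s₀)`, from the first time on: the expected total reward over trajectories. -/
def value (P : Fin H → S → A → S → ℝ) (r : Fin H → S → A → ℝ) (π : Policy S A H) (s₀ : S) : ℝ :=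
  ∑ x : Fin (H + 1) → S,
    pathProb P π s₀ x * ∑ t : Fin H, r t (x t.castSucc) (π t (x t.castSucc))

namespace NominalMDP

variable (M : NominalMDP S A H)

/-- The rectangular KL uncertainty set: every time-state-action triple has its own KL ball. -/
def uncertaintySet (ρ : ℝ) : Set (Fin H → S → A → S → ℝ) :=
  {P | ∀ h s a, P h s a ∈ klBall ρ (M.trans h s a)}

/-- Robust value of a policy: the infimum of its values over the uncertainty set. -/
def robustValue (ρ : ℝ) (π : Policy S A H) (s : S) : ℝ :=
  ⨅ P : M.uncertaintySet ρ, value P.1 M.reward π s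

/-- Optimal robust value: the supremum of the robust values over all policies. -/
def optRobustValue (ρ : ℝ) (s : S) : ℝ :=
  ⨆ π : Policy S A H, M.robustValue ρ π s

/-- The smallest positive nominal transition probability. -/
def pmin : ℝ :=
  sInf {p | 0 < p ∧ ∃ h s a s', p = M.trans h s a s'}

end NominalMDP

/-- Value functions computed by robust phased value learning from an estimated model `Q`, by
backward recursion: `0` at time `H + 1`, and the robust Bellman update at each earlier time. -/
def rpvlValue (ρ : ℝ) (r : Fin H → S → A → ℝ) (Q : Fin H → S → A → S → ℝ) (h : Fin (H + 1)) :
    S → ℝ :=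
  Fin.reverseInduction (motive := fun _ => S → ℝ) (fun _ => 0)
    (fun h V s => ⨆ a : A, r h s a + worstExp ρ (Q h s a) V) h

/-- All possible outputs of robust phased value learning run on the estimated model `Q`, that
is, all choices of maximizing actions (ties may be broken in any way). -/
def rpvlOutputs (ρ : ℝ) (r : Fin H → S → A → ℝ) (Q : Fin H → S → A → S → ℝ) :
    Set (Policy S A H) :=
  {π | ∀ h s, ∀ a : A,
    r h s a + worstExp ρ (Q h s a) (rpvlValue ρ r Q h.succ) ≤
      r h s (π h s) + worstExp ρ (Q h s (π h s)) (rpvlValue ρ r Q h.succ)}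

end Values

section Sampling

variable {S A Ω : Type*} {H N : ℕ}

/-- `X h s a i` is the `i`-th next-state sample drawn at `(h, s, a)` from the generative model:
all samples are jointly independent, and those at `(h, s, a)` have law `M.trans h s a`. -/
structure IsGenerativeSample [Fintype S] [MeasurableSpace S] [MeasurableSpace Ω]
    (M : NominalMDP S A H) (μ : MeasureTheory.Measure Ω)
    (X : Fin H → S → A → Fin N → Ω → S) : Prop where
  measurable : ∀ h s a i, Measurable (X h s a i)
  law : ∀ h s a i s', μ.real {ω | X h s a i ω = s'} = M.trans h s a s'
  indep : ProbabilityTheory.iIndepFun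
    (fun k : Fin H × S × A × Fin N => X k.1 k.2.1 k.2.2.1 k.2.2.2) μ

open Classical in
/-- Maximum likelihood estimate of the transition model: the empirical frequencies. -/
def empirical (X : Fin H → S → A → Fin N → Ω → S) (ω : Ω) : Fin H → S → A → S → ℝ :=
  fun h s a s' => ((Finset.univ.filter fun i : Fin N => X h s a i ω = s').card : ℝ) / N

end Sampling

end RobustMDP

end

/-!
The robust value of a policy satisfies a backward recursion in which each step takes the worst
expectation over one KL ball, and the value computed by the algorithm is the maximum, attained by
its output, of the same recursion run on the estimated model. It therefore suffices to compare, for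
a fixed policy, the recursions around the two models. If `p ≤ exp κ • q` pointwise, a member of the
KL ball of radius `ρ` around `p` lies in that of radius `ρ + κ` around `q`, and mixing it with
weight `κ / (ρ + κ)` with `q` brings it back to radius `ρ`; so one step costs at most
`κ / ρ * ‖V‖∞`, and the whole recursion `κ / ρ * H * (H - 1) / 2`. Hoeffding's inequality, applied
at the scale `c * pmin`, makes all empirical frequencies accurate up to a relative error `c`; the
ratio condition then holds in both directions with `κ = 2 * c` as long as `c² ≤ 1 / 2`.
-/

namespace RobustMDP

section LowerExpectation

variable {S : Type*} [Fintype S] {U : Set (S → ℝ)} {P V V' : S → ℝ} {B d : ℝ}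

theorem sum_mul_mem_Icc (hP : P ∈ stdSimplex ℝ S) (hV : ∀ s, V s ∈ Set.Icc 0 B) :
    ∑ s, P s * V s ∈ Set.Icc 0 B :=
  (convex_Icc 0 B).sum_mem (fun s _ => hP.1 s) hP.2 fun s _ => hV s

theorem sum_mul_const_add {ι : Type*} [Fintype ι] {w : ι → ℝ} (hw : ∑ i, w i = 1) (a : ℝ)
    (f : ι → ℝ) : ∑ i, w i * (a + f i) = a + ∑ i, w i * f i := by
  simp_rw [mul_add, Finset.sum_add_distrib, ← Finset.sum_mul, hw, one_mul]

theorem sum_mul_le_sum_mul_add (hP : P ∈ stdSimplex ℝ S) (hV : ∀ s, V s ≤ V' s + d) :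
    ∑ s, P s * V s ≤ ∑ s, P s * V' s + d :=
  calc ∑ s, P s * V s ≤ ∑ s, P s * (d + V' s) := Finset.sum_le_sum fun s _ =>
        mul_le_mul_of_nonneg_left ((hV s).trans_eq (add_comm _ _)) (hP.1 s)
    _ = ∑ s, P s * V' s + d := by rw [sum_mul_const_add hP.2, add_comm]

/-- The lower expectation of `V` over a set `U` of probability vectors; `worstExp` is the case of
a KL ball. -/
noncomputable def lowerExp (U : Set (S → ℝ)) (V : S → ℝ) : ℝ :=
  sInf ((fun P : S → ℝ => ∑ s, P s * V s) '' U)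

theorem lowerExp_le_sum_mul (hU : U ⊆ stdSimplex ℝ S) (hP : P ∈ U) (V : S → ℝ) :
    lowerExp U V ≤ ∑ s, P s * V s := by
  have hcompact := (isCompact_stdSimplex ℝ S).image (f := fun P : S → ℝ => ∑ s, P s * V s)
    (by fun_prop)
  exact csInf_le (hcompact.bddBelow.mono (Set.image_mono hU)) ⟨P, hP, rfl⟩

theorem le_lowerExp (hne : U.Nonempty) (h : ∀ P ∈ U, d ≤ ∑ s, P s * V s) : d ≤ lowerExp U V :=
  le_csInf (hne.image _) (Set.forall_mem_image.2 h)

theorem exists_sum_mul_lt_of_lowerExp_lt (hne : U.Nonempty) (h : lowerExp U V < d) :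
    ∃ P ∈ U, ∑ s, P s * V s < d :=
  Set.exists_mem_image.1 (exists_lt_of_csInf_lt (hne.image _) h)

theorem lowerExp_le_lowerExp_add (hU : U ⊆ stdSimplex ℝ S) (hne : U.Nonempty)
    (hV : ∀ s, V s ≤ V' s + d) : lowerExp U V ≤ lowerExp U V' + d :=
  sub_le_iff_le_add.1 <| le_lowerExp hne fun _ hP => sub_le_iff_le_add.2 <|
    (lowerExp_le_sum_mul hU hP V).trans (sum_mul_le_sum_mul_add (hU hP) hV)

theorem lowerExp_mem_Icc (hU : U ⊆ stdSimplex ℝ S) (hne : U.Nonempty)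
    (hV : ∀ s, V s ∈ Set.Icc 0 B) : lowerExp U V ∈ Set.Icc 0 B := by
  obtain ⟨P, hP⟩ := hne
  exact ⟨le_lowerExp ⟨P, hP⟩ fun P' hP' => (sum_mul_mem_Icc (hU hP') hV).1,
    (lowerExp_le_sum_mul hU hP V).trans (sum_mul_mem_Icc (hU hP) hV).2⟩

end LowerExpectation

section KLBall

variable {S : Type*} [Fintype S] {ρ κ : ℝ} {P p q : S → ℝ}

theorem mem_klBall_iff :
    P ∈ klBall ρ q ↔ P ∈ stdSimplex ℝ S ∧ (∀ s, q s = 0 → P s = 0) ∧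
      ∑ s, P s * Real.log (P s / q s) ≤ ρ := by
  change (_ ∧ klDist P q ≤ (ρ : EReal)) ↔ _
  by_cases h : ∀ s, q s = 0 → P s = 0
  · rw [klDist, if_pos h, EReal.coe_le_coe_iff, and_iff_right h]
  · simp [klDist, h]

theorem klBall_subset_stdSimplex : klBall ρ q ⊆ stdSimplex ℝ S :=
  fun _ hP => hP.1

theorem self_mem_klBall (hρ : 0 ≤ ρ) (hq : q ∈ stdSimplex ℝ S) : q ∈ klBall ρ q := by
  refine mem_klBall_iff.2 ⟨hq, fun _ h => h, ?_⟩
  rwa [Finset.sum_eq_zero fun s _ => by by_cases h : q s = 0 <;> simp [h]]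

theorem mul_log_div_le_mul_log_div_add {x a b : ℝ} (hx : 0 ≤ x) (ha : 0 ≤ a)
    (hxa : a = 0 → x = 0) (hab : a ≤ Real.exp κ * b) :
    x * Real.log (x / b) ≤ x * Real.log (x / a) + x * κ := by
  rcases hx.eq_or_lt with rfl | hx
  · simp
  have ha : 0 < a := ha.lt_of_ne fun h => hx.ne' (hxa h.symm)
  have hb : 0 < b := pos_of_mul_pos_right (ha.trans_le hab) (Real.exp_pos κ).le
  have hlog : Real.log a ≤ κ + Real.log b := by
    simpa [Real.log_mul (Real.exp_pos κ).ne' hb.ne'] using Real.log_le_log ha hab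
  rw [← mul_add, Real.log_div hx.ne' hb.ne', Real.log_div hx.ne' ha.ne']
  exact mul_le_mul_of_nonneg_left (by linarith) hx.le

theorem klBall_subset_klBall_add (hp : ∀ s, 0 ≤ p s) (hpq : ∀ s, p s ≤ Real.exp κ * q s) :
    klBall ρ p ⊆ klBall (ρ + κ) q := by
  intro P hP
  obtain ⟨hPs, hPp, hkl⟩ := mem_klBall_iff.1 hP
  refine mem_klBall_iff.2 ⟨hPs, fun s hs => hPp s ?_, ?_⟩
  · exact (hp s).antisymm' (by simpa [hs] using hpq s)
  · calc ∑ s, P s * Real.log (P s / q s)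
        ≤ ∑ s, (P s * Real.log (P s / p s) + P s * κ) := Finset.sum_le_sum fun s _ =>
          mul_log_div_le_mul_log_div_add (hPs.1 s) (hp s) (hPp s) (hpq s)
      _ = ∑ s, P s * Real.log (P s / p s) + κ := by
          rw [Finset.sum_add_distrib, ← Finset.sum_mul, hPs.2, one_mul]
      _ ≤ ρ + κ := by gcongr

theorem mix_mul_log_div_le {x b t : ℝ} (hx : 0 ≤ x) (hb : 0 < b) (ht : t ∈ Set.Icc (0 : ℝ) 1) :
    ((1 - t) * x + t * b) * Real.log (((1 - t) * x + t * b) / b) ≤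
      (1 - t) * (x * Real.log (x / b)) := by
  have hconv := Real.convexOn_mul_log.2 (x := x / b) (y := 1) (Set.mem_Ici.2 (by positivity))
    (Set.mem_Ici.2 zero_le_one) (sub_nonneg.2 ht.2) ht.1 (by ring)
  simp only [smul_eq_mul, Real.log_one, mul_zero, add_zero, mul_one] at hconv
  have hscale : ((1 - t) * x + t * b) / b = (1 - t) * (x / b) + t := by field_simp
  calc ((1 - t) * x + t * b) * Real.log (((1 - t) * x + t * b) / b)
      = b * (((1 - t) * (x / b) + t) * Real.log ((1 - t) * (x / b) + t)) := by
        rw [hscale]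
        field_simp
    _ ≤ b * ((1 - t) * (x / b * Real.log (x / b))) := mul_le_mul_of_nonneg_left hconv hb.le
    _ = (1 - t) * (x * Real.log (x / b)) := by field_simp

theorem mix_mem_klBall (hq : q ∈ stdSimplex ℝ S) (hP : P ∈ klBall ρ q) {t : ℝ}
    (ht : t ∈ Set.Icc (0 : ℝ) 1) : (1 - t) • P + t • q ∈ klBall ((1 - t) * ρ) q := by
  obtain ⟨hPs, hPq, hkl⟩ := mem_klBall_iff.1 hP
  have h1t : 0 ≤ 1 - t := sub_nonneg.2 ht.2
  refine mem_klBall_iff.2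
    ⟨convex_stdSimplex ℝ S hPs hq h1t ht.1 (by ring), fun s hs => by simp [hs, hPq s hs], ?_⟩
  calc ∑ s, ((1 - t) * P s + t * q s) * Real.log (((1 - t) * P s + t * q s) / q s)
      ≤ ∑ s, (1 - t) * (P s * Real.log (P s / q s)) := by
        refine Finset.sum_le_sum fun s _ => ?_
        rcases (hq.1 s).eq_or_lt with h0 | h0
        · simp [← h0, hPq s h0.symm]
        · exact mix_mul_log_div_le (hPs.1 s) h0 ht
    _ ≤ (1 - t) * ρ := by
        rw [← Finset.mul_sum]
        exact mul_le_mul_of_nonneg_left hkl h1t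

theorem lowerExp_klBall_le_add (hρ : 0 < ρ) (hκ : 0 ≤ κ) (hp : p ∈ stdSimplex ℝ S)
    (hq : q ∈ stdSimplex ℝ S) (hpq : ∀ s, p s ≤ Real.exp κ * q s) {V : S → ℝ} {B : ℝ}
    (hV : ∀ s, V s ∈ Set.Icc 0 B) :
    lowerExp (klBall ρ q) V ≤ lowerExp (klBall ρ p) V + κ / ρ * B := by
  refine sub_le_iff_le_add.1 (le_lowerExp ⟨p, self_mem_klBall hρ.le hp⟩ fun P hP => ?_)
  rw [sub_le_iff_le_add]
  have hρκ : 0 < ρ + κ := by positivity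
  set t := κ / (ρ + κ)
  have ht : t ∈ Set.Icc (0 : ℝ) 1 := ⟨by positivity, (div_le_one hρκ).2 (by linarith)⟩
  have htρ : t ≤ κ / ρ := div_le_div_of_nonneg_left hκ hρ (by linarith)
  have hradius : (1 - t) * (ρ + κ) = ρ := by
    rw [sub_mul, one_mul, div_mul_cancel₀ _ hρκ.ne', add_sub_cancel_right]
  have hmix : (1 - t) • P + t • q ∈ klBall ρ q :=
    hradius ▸ mix_mem_klBall hq (klBall_subset_klBall_add hp.1 hpq hP) ht
  have hPV := sum_mul_mem_Icc hP.1 hV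
  have hqV := sum_mul_mem_Icc hq hV
  calc lowerExp (klBall ρ q) V
      ≤ ∑ s, ((1 - t) * P s + t * q s) * V s :=
        lowerExp_le_sum_mul klBall_subset_stdSimplex hmix V
    _ = (1 - t) * ∑ s, P s * V s + t * ∑ s, q s * V s := by
        simp_rw [add_mul, Finset.sum_add_distrib, Finset.mul_sum, mul_assoc]
    _ ≤ 1 * ∑ s, P s * V s + κ / ρ * B := by
        gcongr
        · exact hPV.1
        · linarith [ht.1]
        · exact hqV.1
        · exact hqV.2
    _ = ∑ s, P s * V s + κ / ρ * B := by rw [one_mul]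

end KLBall

section PolicyEvaluation

variable {S A : Type*} {H : ℕ}

theorem pathProb_eq_zero {P : Fin H → S → A → S → ℝ} {π : Policy S A H} {s₀ : S}
    {x : Fin (H + 1) → S} (hx : x 0 ≠ s₀) : pathProb P π s₀ x = 0 := by
  simp [pathProb, hx]

theorem pathProb_cons (P : Fin (H + 1) → S → A → S → ℝ) (π : Policy S A (H + 1)) (s₀ : S)
    (y : Fin (H + 1) → S) :
    pathProb P π s₀ (Fin.cons s₀ y : Fin (H + 2) → S) =
      P 0 s₀ (π 0 s₀) (y 0) * pathProb (Fin.tail P) (Fin.tail π) (y 0) y := by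
  simp [pathProb, Fin.prod_univ_succ, Fin.tail]

variable [Fintype S]

theorem sum_pathProb_mul (P : Fin (H + 1) → S → A → S → ℝ) (π : Policy S A (H + 1)) (s₀ : S)
    (f : (Fin (H + 2) → S) → ℝ) :
    ∑ x, pathProb P π s₀ x * f x =
      ∑ s, P 0 s₀ (π 0 s₀) s *
        ∑ y, pathProb (Fin.tail P) (Fin.tail π) s y * f (Fin.cons s₀ y) := by
  rw [← (Fin.consEquiv fun _ => S).sum_comp, Fintype.sum_prod_type, Fintype.sum_eq_single s₀
    fun s hs => Finset.sum_eq_zero fun y _ => by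
      rw [pathProb_eq_zero (by simpa [Fin.consEquiv] using hs), zero_mul]]
  simp_rw [Finset.mul_sum]
  rw [Finset.sum_comm]
  refine Finset.sum_congr rfl fun y _ => ?_
  rw [Fintype.sum_eq_single (y 0) fun s hs => by rw [pathProb_eq_zero hs.symm, zero_mul, mul_zero],
    ← mul_assoc]
  exact congrArg (· * _) (pathProb_cons P π s₀ y)

theorem sum_pathProb {P : Fin H → S → A → S → ℝ} (hP : ∀ h s a, P h s a ∈ stdSimplex ℝ S)
    (π : Policy S A H) (s₀ : S) : ∑ x, pathProb P π s₀ x = 1 := by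
  induction H generalizing s₀ with
  | zero =>
    rw [Fintype.sum_eq_single (fun _ => s₀) fun x hx => pathProb_eq_zero fun h =>
      hx (funext fun i => by rwa [Fin.fin_one_eq_zero i])]
    simp [pathProb]
  | succ H ih =>
    have hstep := sum_pathProb_mul P π s₀ fun _ => 1
    simp only [mul_one, ih (P := Fin.tail P) fun h => hP h.succ, (hP 0 s₀ (π 0 s₀)).2] at hstep
    exact hstep

theorem value_horizon_zero (P : Fin 0 → S → A → S → ℝ) (r : Fin 0 → S → A → ℝ)
    (π : Policy S A 0) (s₀ : S) : value P r π s₀ = 0 := by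
  simp [value]

theorem value_succ {P : Fin (H + 1) → S → A → S → ℝ} (hP : ∀ h s a, P h s a ∈ stdSimplex ℝ S)
    (r : Fin (H + 1) → S → A → ℝ) (π : Policy S A (H + 1)) (s₀ : S) :
    value P r π s₀ = r 0 s₀ (π 0 s₀) +
      ∑ s, P 0 s₀ (π 0 s₀) s * value (Fin.tail P) (Fin.tail r) (Fin.tail π) s := by
  have htail : ∀ s, ∑ y, pathProb (Fin.tail P) (Fin.tail π) s y = 1 :=
    sum_pathProb (fun h => hP h.succ) _
  rw [value, sum_pathProb_mul]
  simp only [value, Fin.sum_univ_succ (n := H), ← Fin.succ_castSucc, Fin.cons_succ,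
    Fin.castSucc_zero, Fin.cons_zero, sum_mul_const_add (htail _),
    sum_mul_const_add (hP 0 s₀ (π 0 s₀)).2]
  rfl

end PolicyEvaluation

section RobustPolicyEvaluation

variable {S A : Type*} [Fintype S] {H : ℕ}

/-- Value of a policy by robust dynamic programming, for a rectangular family `𝒰` of uncertainty
sets: backward recursion with a worst expectation over `𝒰 h s a` at each step. -/
noncomputable def robustPolicyValue : {H : ℕ} → (Fin H → S → A → Set (S → ℝ)) →
    (Fin H → S → A → ℝ) → Policy S A H → S → ℝ
  | 0, _, _, _ => 0
  | _ + 1, 𝒰, r, π => fun s => r 0 s (π 0 s) +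
      lowerExp (𝒰 0 s (π 0 s)) (robustPolicyValue (Fin.tail 𝒰) (Fin.tail r) (Fin.tail π))

variable {𝒰 𝒲 : Fin H → S → A → Set (S → ℝ)} {r : Fin H → S → A → ℝ}

theorem robustPolicyValue_le_value (h𝒰 : ∀ h s a, 𝒰 h s a ⊆ stdSimplex ℝ S)
    {P : Fin H → S → A → S → ℝ} (hP : ∀ h s a, P h s a ∈ 𝒰 h s a) (r : Fin H → S → A → ℝ)
    (π : Policy S A H) (s : S) : robustPolicyValue 𝒰 r π s ≤ value P r π s := by
  induction H generalizing s with
  | zero => simp [robustPolicyValue, value_horizon_zero]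
  | succ H ih =>
    rw [value_succ fun h s a => h𝒰 h s a (hP h s a)]
    have hP₀ := hP 0 s (π 0 s)
    refine add_le_add_right ((lowerExp_le_sum_mul (h𝒰 0 s (π 0 s)) hP₀ _).trans ?_) _
    exact Finset.sum_le_sum fun s' _ => mul_le_mul_of_nonneg_left
      (ih (fun h => h𝒰 h.succ) (fun h => hP h.succ) _ _ s') ((h𝒰 0 s _ hP₀).1 s')

theorem exists_value_le_robustPolicyValue_add (h𝒰 : ∀ h s a, 𝒰 h s a ⊆ stdSimplex ℝ S)
    (hne : ∀ h s a, (𝒰 h s a).Nonempty) (r : Fin H → S → A → ℝ) (π : Policy S A H) {η : ℝ}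
    (hη : 0 < η) :
    ∃ P : Fin H → S → A → S → ℝ, (∀ h s a, P h s a ∈ 𝒰 h s a) ∧
      ∀ s, value P r π s ≤ robustPolicyValue 𝒰 r π s + η := by
  induction H generalizing η with
  | zero => exact ⟨nofun, nofun, fun s => by simp [robustPolicyValue, value_horizon_zero, hη.le]⟩
  | succ H ih =>
    set V := robustPolicyValue (Fin.tail 𝒰) (Fin.tail r) (Fin.tail π) with hV
    obtain ⟨P, hP, hPV⟩ := ih (𝒰 := Fin.tail 𝒰) (fun h => h𝒰 h.succ) (fun h => hne h.succ)
      (Fin.tail r) (Fin.tail π) (half_pos hη)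
    have hfirst : ∀ s a, ∃ p ∈ 𝒰 0 s a, ∑ s', p s' * V s' < lowerExp (𝒰 0 s a) V + η / 2 :=
      fun s a => exists_sum_mul_lt_of_lowerExp_lt (hne 0 s a) (lt_add_of_pos_right _ (half_pos hη))
    choose p hp hpV using hfirst
    have hmem : ∀ h s a, (Fin.cons p P : Fin (H + 1) → S → A → S → ℝ) h s a ∈ 𝒰 h s a :=
      Fin.cases hp hP
    refine ⟨Fin.cons p P, hmem, fun s => ?_⟩
    have hfuture := sum_mul_le_sum_mul_add (h𝒰 0 s (π 0 s) (hp s (π 0 s))) hPV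
    rw [value_succ fun h s a => h𝒰 h s a (hmem h s a), robustPolicyValue, ← hV]
    simp only [Fin.cons_zero, Fin.tail_cons]
    linarith [hpV s (π 0 s)]

theorem iInf_value_eq_robustPolicyValue (h𝒰 : ∀ h s a, 𝒰 h s a ⊆ stdSimplex ℝ S)
    (hne : ∀ h s a, (𝒰 h s a).Nonempty) (r : Fin H → S → A → ℝ) (π : Policy S A H) (s : S) :
    ⨅ P : {P : Fin H → S → A → S → ℝ | ∀ h s a, P h s a ∈ 𝒰 h s a}, value P.1 r π s =
      robustPolicyValue 𝒰 r π s := by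
  choose P hP using hne
  have : Nonempty {P : Fin H → S → A → S → ℝ | ∀ h s a, P h s a ∈ 𝒰 h s a} := ⟨⟨P, hP⟩⟩
  refine ciInf_eq_of_forall_ge_of_forall_gt_exists_lt
    (fun P => robustPolicyValue_le_value h𝒰 P.2 r π s) fun w hw => ?_
  obtain ⟨η, hη, hηw⟩ := exists_between (sub_pos.2 hw)
  obtain ⟨P, hP, hle⟩ :=
    exists_value_le_robustPolicyValue_add h𝒰 (fun h s a => ⟨_, hP h s a⟩) r π hη
  exact ⟨⟨P, hP⟩, (hle s).trans_lt (by linarith)⟩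

theorem robustPolicyValue_mem_Icc (h𝒰 : ∀ h s a, 𝒰 h s a ⊆ stdSimplex ℝ S)
    (hne : ∀ h s a, (𝒰 h s a).Nonempty) (hr : ∀ h s a, r h s a ∈ Set.Icc (0 : ℝ) 1)
    (π : Policy S A H) (s : S) : robustPolicyValue 𝒰 r π s ∈ Set.Icc (0 : ℝ) H := by
  induction H generalizing s with
  | zero => simp [robustPolicyValue]
  | succ H ih =>
    have hfuture := lowerExp_mem_Icc (h𝒰 0 s (π 0 s)) (hne 0 s (π 0 s))
      (ih (fun h => h𝒰 h.succ) (fun h => hne h.succ) (fun h => hr h.succ) (Fin.tail π))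
    have hnow := hr 0 s (π 0 s)
    push_cast
    exact ⟨add_nonneg hnow.1 hfuture.1, by
      rw [add_comm (H : ℝ)]
      exact add_le_add hnow.2 hfuture.2⟩

theorem robustPolicyValue_le_add (h𝒰 : ∀ h s a, 𝒰 h s a ⊆ stdSimplex ℝ S)
    (h𝒰ne : ∀ h s a, (𝒰 h s a).Nonempty) (h𝒲 : ∀ h s a, 𝒲 h s a ⊆ stdSimplex ℝ S)
    (h𝒲ne : ∀ h s a, (𝒲 h s a).Nonempty) (hr : ∀ h s a, r h s a ∈ Set.Icc (0 : ℝ) 1) {c : ℝ}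
    (hstep : ∀ h s a (V : S → ℝ) (B : ℝ), (∀ s', V s' ∈ Set.Icc 0 B) →
      lowerExp (𝒲 h s a) V ≤ lowerExp (𝒰 h s a) V + c * B)
    (π : Policy S A H) (s : S) :
    robustPolicyValue 𝒲 r π s ≤ robustPolicyValue 𝒰 r π s + c * (H * (H - 1) / 2) := by
  induction H generalizing s with
  | zero => simp [robustPolicyValue]
  | succ H ih =>
    have hfuture := lowerExp_le_lowerExp_add (h𝒰 0 s (π 0 s)) (h𝒰ne 0 s (π 0 s))
      (ih (𝒰 := Fin.tail 𝒰) (𝒲 := Fin.tail 𝒲) (r := Fin.tail r) (fun h => h𝒰 h.succ)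
        (fun h => h𝒰ne h.succ) (fun h => h𝒲 h.succ) (fun h => h𝒲ne h.succ)
        (fun h => hr h.succ) (fun h => hstep h.succ) (Fin.tail π))
    have hnow := hstep 0 s (π 0 s) _ _ (robustPolicyValue_mem_Icc (𝒰 := Fin.tail 𝒲)
      (r := Fin.tail r) (fun h => h𝒲 h.succ) (fun h => h𝒲ne h.succ) (fun h => hr h.succ)
      (Fin.tail π))
    simp only [robustPolicyValue, Nat.cast_add_one]
    linarith

theorem robustPolicyValue_klBall_le_add {ρ κ : ℝ} (hρ : 0 < ρ) (hκ : 0 ≤ κ)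
    {P Q : Fin H → S → A → S → ℝ} (hP : ∀ h s a, P h s a ∈ stdSimplex ℝ S)
    (hQ : ∀ h s a, Q h s a ∈ stdSimplex ℝ S)
    (hPQ : ∀ h s a s', P h s a s' ≤ Real.exp κ * Q h s a s')
    (hr : ∀ h s a, r h s a ∈ Set.Icc (0 : ℝ) 1) (π : Policy S A H) (s : S) :
    robustPolicyValue (fun h s a => klBall ρ (Q h s a)) r π s ≤
      robustPolicyValue (fun h s a => klBall ρ (P h s a)) r π s + κ / ρ * (H * (H - 1) / 2) :=
  robustPolicyValue_le_add
    (fun _ _ _ => klBall_subset_stdSimplex) (fun h s a => ⟨_, self_mem_klBall hρ.le (hP h s a)⟩)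
    (fun _ _ _ => klBall_subset_stdSimplex) (fun h s a => ⟨_, self_mem_klBall hρ.le (hQ h s a)⟩)
    hr (fun h s a _ _ => lowerExp_klBall_le_add hρ hκ (hP h s a) (hQ h s a) (hPQ h s a)) π s

end RobustPolicyEvaluation

section RPVL

variable {S A : Type*} [Fintype S] {H : ℕ} {ρ : ℝ}

theorem rpvlValue_last (ρ : ℝ) (r : Fin H → S → A → ℝ) (Q : Fin H → S → A → S → ℝ) :
    rpvlValue ρ r Q (Fin.last H) = 0 :=
  Fin.reverseInduction_last ..

theorem rpvlValue_castSucc (ρ : ℝ) (r : Fin H → S → A → ℝ) (Q : Fin H → S → A → S → ℝ)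
    (h : Fin H) :
    rpvlValue ρ r Q h.castSucc =
      fun s => ⨆ a : A, r h s a + worstExp ρ (Q h s a) (rpvlValue ρ r Q h.succ) :=
  Fin.reverseInduction_castSucc ..

theorem rpvlValue_tail (ρ : ℝ) (r : Fin (H + 1) → S → A → ℝ) (Q : Fin (H + 1) → S → A → S → ℝ)
    (h : Fin (H + 1)) :
    rpvlValue ρ (Fin.tail r) (Fin.tail Q) h = rpvlValue ρ r Q h.succ := by
  induction h using Fin.reverseInduction with
  | last => rw [rpvlValue_last, Fin.succ_last, rpvlValue_last]
  | cast h ih =>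
    rw [rpvlValue_castSucc, Fin.succ_castSucc, rpvlValue_castSucc, ih]
    rfl

theorem rpvlValue_zero_apply (ρ : ℝ) (r : Fin (H + 1) → S → A → ℝ)
    (Q : Fin (H + 1) → S → A → S → ℝ) (s : S) :
    rpvlValue ρ r Q 0 s =
      ⨆ a : A, r 0 s a + worstExp ρ (Q 0 s a) (rpvlValue ρ (Fin.tail r) (Fin.tail Q) 0) := by
  rw [rpvlValue_tail]
  exact congrFun (rpvlValue_castSucc ρ r Q 0) s

theorem tail_mem_rpvlOutputs {r : Fin (H + 1) → S → A → ℝ} {Q : Fin (H + 1) → S → A → S → ℝ}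
    {π : Policy S A (H + 1)} (hπ : π ∈ rpvlOutputs ρ r Q) :
    Fin.tail π ∈ rpvlOutputs ρ (Fin.tail r) (Fin.tail Q) := by
  intro h s a
  rw [rpvlValue_tail]
  exact hπ h.succ s a

theorem robustPolicyValue_le_rpvlValue [Finite A] (hρ : 0 ≤ ρ) {Q : Fin H → S → A → S → ℝ}
    (hQ : ∀ h s a, Q h s a ∈ stdSimplex ℝ S) (r : Fin H → S → A → ℝ) (π : Policy S A H) (s : S) :
    robustPolicyValue (fun h s a => klBall ρ (Q h s a)) r π s ≤ rpvlValue ρ r Q 0 s := by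
  induction H generalizing s with
  | zero => exact (congrFun (rpvlValue_last ρ r Q) s).ge
  | succ H ih =>
    have hfuture := lowerExp_le_lowerExp_add (d := 0) klBall_subset_stdSimplex
      ⟨_, self_mem_klBall hρ (hQ 0 s (π 0 s))⟩
      fun s' => (ih (fun h => hQ h.succ) (Fin.tail r) (Fin.tail π) s').trans_eq (add_zero _).symm
    rw [add_zero] at hfuture
    rw [rpvlValue_zero_apply]
    exact (add_le_add_right hfuture _).trans
      (le_ciSup (f := fun a => r 0 s a + worstExp ρ (Q 0 s a) _) (Set.finite_range _).bddAbove
        (π 0 s))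

theorem robustPolicyValue_eq_rpvlValue {r : Fin H → S → A → ℝ} {Q : Fin H → S → A → S → ℝ}
    {π : Policy S A H} (hπ : π ∈ rpvlOutputs ρ r Q) :
    robustPolicyValue (fun h s a => klBall ρ (Q h s a)) r π = rpvlValue ρ r Q 0 := by
  induction H with
  | zero => exact (rpvlValue_last ρ r Q).symm
  | succ H ih =>
    funext s
    have hgreatest : IsGreatest (Set.range fun a => r 0 s a +
        worstExp ρ (Q 0 s a) (rpvlValue ρ (Fin.tail r) (Fin.tail Q) 0))
        (r 0 s (π 0 s) +
          worstExp ρ (Q 0 s (π 0 s)) (rpvlValue ρ (Fin.tail r) (Fin.tail Q) 0)) := by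
      refine ⟨⟨π 0 s, rfl⟩, Set.forall_mem_range.2 fun a => ?_⟩
      rw [rpvlValue_tail]
      exact hπ 0 s a
    rw [rpvlValue_zero_apply, iSup, hgreatest.csSup_eq, ← ih (tail_mem_rpvlOutputs hπ)]
    rfl

end RPVL

namespace NominalMDP

variable {S A : Type*} [Fintype S] {H : ℕ} {ρ : ℝ} (M : NominalMDP S A H)

theorem robustValue_eq_robustPolicyValue (hρ : 0 ≤ ρ) (π : Policy S A H) (s : S) :
    M.robustValue ρ π s = robustPolicyValue (fun h s a => klBall ρ (M.trans h s a)) M.reward π s :=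
  iInf_value_eq_robustPolicyValue (fun _ _ _ => klBall_subset_stdSimplex)
    (fun h s a => ⟨_, self_mem_klBall hρ (M.trans_mem h s a)⟩) M.reward π s

theorem norm_optRobustValue_sub_robustValue_le [Finite A] (hρ : 0 < ρ) {κ : ℝ} (hκ : 0 ≤ κ)
    {Q : Fin H → S → A → S → ℝ} (hQ : ∀ h s a, Q h s a ∈ stdSimplex ℝ S)
    (hMQ : ∀ h s a s', M.trans h s a s' ≤ Real.exp κ * Q h s a s')
    (hQM : ∀ h s a s', Q h s a s' ≤ Real.exp κ * M.trans h s a s')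
    {πhat : Policy S A H} (hπhat : πhat ∈ rpvlOutputs ρ M.reward Q) :
    ‖M.optRobustValue ρ - M.robustValue ρ πhat‖ ≤ κ / ρ * H ^ 2 := by
  have : Nonempty (Policy S A H) := ⟨πhat⟩
  have hκρ : 0 ≤ κ / ρ := by positivity
  refine (pi_norm_le_iff_of_nonneg (by positivity)).2 fun s => ?_
  have hle : M.optRobustValue ρ s ≤ M.robustValue ρ πhat s + κ / ρ * H ^ 2 := by
    refine ciSup_le fun π => ?_
    rw [M.robustValue_eq_robustPolicyValue hρ.le, M.robustValue_eq_robustPolicyValue hρ.le]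
    have hgreedy := robustPolicyValue_le_rpvlValue hρ.le hQ M.reward π s
    rw [← robustPolicyValue_eq_rpvlValue hπhat] at hgreedy
    linarith [
      robustPolicyValue_klBall_le_add hρ hκ hQ M.trans_mem hQM M.reward_mem π s,
      robustPolicyValue_klBall_le_add hρ hκ M.trans_mem hQ hMQ M.reward_mem πhat s,
      mul_nonneg hκρ (Nat.cast_nonneg (α := ℝ) H)]
  have hge : M.robustValue ρ πhat s ≤ M.optRobustValue ρ s :=
    le_ciSup (f := fun π => M.robustValue ρ π s) (Set.finite_range _).bddAbove πhat
  rw [Pi.sub_apply, Real.norm_of_nonneg (sub_nonneg.2 hge), sub_le_iff_le_add']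
  exact hle

theorem pmin_nonneg : 0 ≤ M.pmin :=
  Real.sInf_nonneg fun _ hp => hp.1.le

theorem pmin_le {h : Fin H} {s : S} {a : A} {s' : S} (hpos : 0 < M.trans h s a s') :
    M.pmin ≤ M.trans h s a s' :=
  csInf_le ⟨0, fun _ hp => hp.1.le⟩ ⟨hpos, h, s, a, s', rfl⟩

theorem pmin_pos [Finite A] [Nonempty S] [Nonempty A] (hH : 0 < H) : 0 < M.pmin := by
  have hfinite : {p | 0 < p ∧ ∃ h s a s', p = M.trans h s a s'}.Finite := by
    refine (Set.finite_range fun k : Fin H × S × A × S =>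
      M.trans k.1 k.2.1 k.2.2.1 k.2.2.2).subset ?_
    rintro _ ⟨_, h, s, a, s', rfl⟩
    exact ⟨(h, s, a, s'), rfl⟩
  have hne : {p | 0 < p ∧ ∃ h s a s', p = M.trans h s a s'}.Nonempty := by
    obtain ⟨s⟩ := ‹Nonempty S›
    obtain ⟨a⟩ := ‹Nonempty A›
    obtain ⟨s', _, hs'⟩ : ∃ s' ∈ Finset.univ, 0 < M.trans ⟨0, hH⟩ s a s' :=
      Finset.exists_lt_of_sum_lt (f := fun _ => 0) (by simp [(M.trans_mem ⟨0, hH⟩ s a).2])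
    exact ⟨_, hs', _, s, a, s', rfl⟩
  exact (hne.csInf_mem hfinite).1

end NominalMDP

section Concentration

open MeasureTheory ProbabilityTheory

open Classical in
/-- Relative frequencies of the outcomes in a sample of size `N`; `empirical` consists of those of
the samples drawn at each `(h, s, a)`. -/
noncomputable def frequency {Ω E : Type*} {N : ℕ} (Y : Fin N → Ω → E) (ω : Ω) (x : E) : ℝ :=
  ((Finset.univ.filter fun i : Fin N => Y i ω = x).card : ℝ) / N

theorem frequency_mem_stdSimplex {Ω E : Type*} [Fintype E] {N : ℕ} (hN : N ≠ 0)
    (Y : Fin N → Ω → E) (ω : Ω) : frequency Y ω ∈ stdSimplex ℝ E := by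
  classical
  refine ⟨fun x => by unfold frequency; positivity, ?_⟩
  have hcard := Finset.card_eq_sum_card_fiberwise (s := (Finset.univ : Finset (Fin N)))
    (t := (Finset.univ : Finset E)) (f := fun i => Y i ω) fun _ _ => by simp
  simp only [Finset.card_univ, Fintype.card_fin] at hcard
  unfold frequency
  rw [← Finset.sum_div, div_eq_one_iff_eq (Nat.cast_ne_zero.2 hN)]
  exact_mod_cast hcard.symm

variable {Ω : Type*} [MeasurableSpace Ω] {μ : Measure Ω} {E : Type*} {N : ℕ}

theorem measureReal_frequency_ne_zero [IsFiniteMeasure μ] {Y : Fin N → Ω → E} {x : E}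
    (hx : ∀ i, μ.real {ω | Y i ω = x} = 0) : μ.real {ω | frequency Y ω x ≠ 0} = 0 := by
  have hsubset : {ω | frequency Y ω x ≠ 0} ⊆ ⋃ i, {ω | Y i ω = x} := fun ω hω => by
    by_contra hnot
    simp only [Set.mem_iUnion, Set.mem_ofPred_eq, not_exists] at hnot
    exact hω (by simp [frequency, hnot])
  refine le_antisymm ?_ measureReal_nonneg
  calc μ.real {ω | frequency Y ω x ≠ 0} ≤ ∑ i, μ.real {ω | Y i ω = x} :=
        (measureReal_mono hsubset).trans (measureReal_iUnion_fintype_le _)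
    _ = 0 := Finset.sum_eq_zero fun i _ => hx i

theorem measureReal_le_abs_le_of_hasSubgaussianMGF [IsFiniteMeasure μ] {Z : Ω → ℝ} {v : NNReal}
    (hZ : HasSubgaussianMGF Z v μ) {t : ℝ} (ht : 0 ≤ t) :
    μ.real {ω | t ≤ |Z ω|} ≤ 2 * Real.exp (-t ^ 2 / (2 * v)) :=
  calc μ.real {ω | t ≤ |Z ω|} ≤ μ.real ({ω | t ≤ Z ω} ∪ {ω | t ≤ (-Z) ω}) :=
        measureReal_mono fun ω (hω : t ≤ |Z ω|) => le_abs.1 hω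
    _ ≤ μ.real {ω | t ≤ Z ω} + μ.real {ω | t ≤ (-Z) ω} := measureReal_union_le _ _
    _ ≤ 2 * Real.exp (-t ^ 2 / (2 * v)) := by
        rw [two_mul]
        exact add_le_add (hZ.measure_ge_le ht) (hZ.neg.measure_ge_le ht)

variable [IsProbabilityMeasure μ]

theorem measureReal_le_abs_average_sub_le {ι : Type*} [Fintype ι] [Nonempty ι] {Z : ι → Ω → ℝ}
    (hZ : ∀ i, AEMeasurable (Z i) μ) (hindep : iIndepFun Z μ)
    (hmem : ∀ i, ∀ᵐ ω ∂μ, Z i ω ∈ Set.Icc (0 : ℝ) 1) {p : ℝ} (hp : ∀ i, μ[Z i] = p) {t : ℝ}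
    (ht : 0 ≤ t) :
    μ.real {ω | t ≤ |(∑ i, Z i ω) / Fintype.card ι - p|} ≤
      2 * Real.exp (-2 * Fintype.card ι * t ^ 2) := by
  have hn : (0 : ℝ) < Fintype.card ι := by exact_mod_cast Fintype.card_pos
  have hsub : ∀ i, HasSubgaussianMGF (fun ω => Z i ω - p) ((‖(1 : ℝ) - 0‖₊ / 2) ^ 2) μ :=
    fun i => hp i ▸ hasSubgaussianMGF_of_mem_Icc (hZ i) (hmem i)
  have hsum := HasSubgaussianMGF.sum_of_iIndepFun (s := Finset.univ)
    (hindep.comp (fun _ y => y - p) fun _ => measurable_id.sub_const p) fun i _ => hsub i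
  have hdev : ∀ ω, t ≤ |(∑ i, Z i ω) / Fintype.card ι - p| ↔
      Fintype.card ι * t ≤ |∑ i, (Z i ω - p)| := fun ω => by
    have : (∑ i, Z i ω) / Fintype.card ι - p = (∑ i, (Z i ω - p)) / Fintype.card ι := by
      rw [Finset.sum_sub_distrib, Finset.sum_const, Finset.card_univ, nsmul_eq_mul]
      field_simp
    rw [this, abs_div, abs_of_pos hn, le_div_iff₀' hn]
  simp_rw [hdev]
  refine (measureReal_le_abs_le_of_hasSubgaussianMGF hsum (by positivity)).trans_eq ?_
  have hvar : ((∑ _i : ι, (‖(1 : ℝ) - 0‖₊ / 2) ^ 2 : NNReal) : ℝ) = Fintype.card ι / 4 := by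
    rw [Finset.sum_const, Finset.card_univ, nsmul_eq_mul, sub_zero, nnnorm_one]
    push_cast
    ring
  rw [hvar]
  congr 2
  field_simp
  ring

theorem one_sub_sum_le_measureReal_forall {ι : Type*} [Fintype ι] (p : ι → Ω → Prop) :
    1 - ∑ k, μ.real {ω | ¬ p k ω} ≤ μ.real {ω | ∀ k, p k ω} := by
  have hcover : Set.univ ⊆ {ω | ∀ k, p k ω} ∪ ⋃ k, {ω | ¬ p k ω} := fun ω _ => by
    simpa [← not_forall] using em (∀ k, p k ω)
  rw [sub_le_iff_le_add]
  calc 1 = μ.real Set.univ := probReal_univ.symm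
    _ ≤ μ.real ({ω | ∀ k, p k ω} ∪ ⋃ k, {ω | ¬ p k ω}) := measureReal_mono hcover
    _ ≤ μ.real {ω | ∀ k, p k ω} + μ.real (⋃ k, {ω | ¬ p k ω}) := measureReal_union_le _ _
    _ ≤ μ.real {ω | ∀ k, p k ω} + ∑ k, μ.real {ω | ¬ p k ω} := by
        gcongr
        exact measureReal_iUnion_fintype_le _

variable [MeasurableSpace E] [MeasurableSingletonClass E]

theorem measureReal_le_abs_frequency_sub_le (hN : N ≠ 0) {Y : Fin N → Ω → E}
    (hY : ∀ i, Measurable (Y i)) (hindep : iIndepFun Y μ) {x : E} {p : ℝ}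
    (hp : ∀ i, μ.real {ω | Y i ω = x} = p) {t : ℝ} (ht : 0 ≤ t) :
    μ.real {ω | t ≤ |frequency Y ω x - p|} ≤ 2 * Real.exp (-2 * N * t ^ 2) := by
  classical
  have : NeZero N := ⟨hN⟩
  have hind : Measurable (({x} : Set E).indicator (1 : E → ℝ)) :=
    measurable_one.indicator (measurableSet_singleton x)
  have hfreq : ∀ ω, frequency Y ω x =
      (∑ i, ({x} : Set E).indicator (1 : E → ℝ) (Y i ω)) / Fintype.card (Fin N) := fun ω => by
    simp [frequency, Set.indicator_apply, Finset.sum_boole]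
  have hoeffding := measureReal_le_abs_average_sub_le (μ := μ)
    (Z := fun i ω => ({x} : Set E).indicator (1 : E → ℝ) (Y i ω))
    (fun i => (hind.comp (hY i)).aemeasurable) (hindep.comp _ fun _ => hind)
    (fun i => .of_forall fun ω => by by_cases h : Y i ω = x <;> simp [h])
    (fun i => (integral_indicator_one (hY i (measurableSet_singleton x))).trans (hp i)) ht
  simpa only [hfreq, Fintype.card_fin] using hoeffding

theorem measureReal_mul_lt_abs_frequency_sub_le (hN : N ≠ 0) {Y : Fin N → Ω → E}
    (hY : ∀ i, Measurable (Y i)) (hindep : iIndepFun Y μ) {x : E} {p : ℝ}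
    (hp : ∀ i, μ.real {ω | Y i ω = x} = p) {m : ℝ} (hm : 0 ≤ m) (hmp : 0 < p → m ≤ p) {c : ℝ}
    (hc : 0 ≤ c) :
    μ.real {ω | c * p < |frequency Y ω x - p|} ≤ 2 * Real.exp (-2 * N * (c * m) ^ 2) := by
  have hp₀ : 0 ≤ p := hp ⟨0, Nat.pos_of_ne_zero hN⟩ ▸ measureReal_nonneg
  rcases hp₀.eq_or_lt with rfl | hpos
  · calc μ.real {ω | c * 0 < |frequency Y ω x - 0|} = 0 := by
          simpa using measureReal_frequency_ne_zero hp
      _ ≤ 2 * Real.exp (-2 * N * (c * m) ^ 2) := by positivity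
  · have hcm : (c * m) ^ 2 ≤ (c * p) ^ 2 := by gcongr; exact hmp hpos
    calc μ.real {ω | c * p < |frequency Y ω x - p|}
        ≤ μ.real {ω | c * p ≤ |frequency Y ω x - p|} := measureReal_mono fun _ => le_of_lt (α := ℝ)
      _ ≤ 2 * Real.exp (-2 * N * (c * p) ^ 2) :=
          measureReal_le_abs_frequency_sub_le hN hY hindep hp (by positivity)
      _ ≤ 2 * Real.exp (-2 * N * (c * m) ^ 2) := by
          simp only [neg_mul]
          gcongr

variable {S A : Type*} [Fintype S] [Fintype A] [MeasurableSpace S] [MeasurableSingletonClass S]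
  {H : ℕ}

theorem one_sub_le_measureReal_forall_abs_empirical_sub_le (hN : N ≠ 0) (M : NominalMDP S A H)
    {X : Fin H → S → A → Fin N → Ω → S} (hX : ∀ h s a i, Measurable (X h s a i))
    (hlaw : ∀ h s a i s', μ.real {ω | X h s a i ω = s'} = M.trans h s a s')
    (hindep : ∀ h s a, iIndepFun (X h s a) μ) {c : ℝ} (hc : 0 ≤ c) :
    1 - 2 * H * (Fintype.card S : ℝ) ^ 2 * Fintype.card A *
        Real.exp (-(2 * N * (c * M.pmin) ^ 2)) ≤
      μ.real {ω | ∀ h s a s',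
        |empirical X ω h s a s' - M.trans h s a s'| ≤ c * M.trans h s a s'} := by
  have hunion := one_sub_sum_le_measureReal_forall (μ := μ) fun (k : Fin H × S × A × S) ω =>
    |empirical X ω k.1 k.2.1 k.2.2.1 k.2.2.2 - M.trans k.1 k.2.1 k.2.2.1 k.2.2.2| ≤
      c * M.trans k.1 k.2.1 k.2.2.1 k.2.2.2
  have htriple : ∀ h s a s', μ.real {ω | ¬ |empirical X ω h s a s' - M.trans h s a s'| ≤
      c * M.trans h s a s'} ≤ 2 * Real.exp (-2 * N * (c * M.pmin) ^ 2) := fun h s a s' => by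
    simp only [not_le]
    exact measureReal_mul_lt_abs_frequency_sub_le hN (hX h s a) (hindep h s a)
      (fun i => hlaw h s a i s') M.pmin_nonneg M.pmin_le hc
  have hsum := Finset.sum_le_sum fun (k : Fin H × S × A × S) (_ : k ∈ Finset.univ) =>
    htriple k.1 k.2.1 k.2.2.1 k.2.2.2
  simp only [Finset.sum_const, Finset.card_univ, Fintype.card_prod, Fintype.card_fin,
    nsmul_eq_mul, Nat.cast_mul, neg_mul] at hsum
  simp only [Prod.forall] at hunion
  linarith

end Concentration

section SampleSize

theorem one_le_one_sub_mul_exp {c : ℝ} (hc : 0 ≤ c) (hc' : c ^ 2 ≤ 1 / 2) :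
    1 ≤ (1 - c) * Real.exp (2 * c) := by
  have hexp := Real.quadratic_le_exp_of_nonneg (x := 2 * c) (by positivity)
  have hc₁ : c ≤ 1 := by nlinarith
  nlinarith [mul_le_mul_of_nonneg_left hexp (sub_nonneg.2 hc₁)]

theorem le_exp_mul_of_abs_sub_le {p q c : ℝ} (hp : 0 ≤ p) (hc : 0 ≤ c) (hc' : c ^ 2 ≤ 1 / 2)
    (h : |q - p| ≤ c * p) : p ≤ Real.exp (2 * c) * q ∧ q ≤ Real.exp (2 * c) * p := by
  obtain ⟨hl, hu⟩ := abs_le.1 h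
  constructor
  · calc p ≤ (1 - c) * Real.exp (2 * c) * p :=
          le_mul_of_one_le_left hp (one_le_one_sub_mul_exp hc hc')
      _ = Real.exp (2 * c) * (p - c * p) := by ring
      _ ≤ Real.exp (2 * c) * q := by gcongr; linarith
  · calc q ≤ (2 * c + 1) * p := by nlinarith
      _ ≤ Real.exp (2 * c) * p := by gcongr; exact Real.add_one_le_exp _

theorem mul_exp_neg_le_of_log_div_le {K δ y : ℝ} (hK : 0 < K) (hδ : 0 < δ)
    (h : Real.log (K / δ) ≤ y) : K * Real.exp (-y) ≤ δ := by
  have hKδ : K ≤ Real.exp y * δ :=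
    (div_le_iff₀ hδ).1 ((Real.log_le_iff_le_exp (div_pos hK hδ)).1 h)
  rwa [Real.exp_neg, ← div_eq_mul_inv, div_le_iff₀' (Real.exp_pos y)]

-- The witness is a minimum: its first term gives the accuracy `ε` and is paid for by `hn`, the
-- second keeps `c ^ 2 ≤ 1 / 2` and is paid for by `hn₀`.
theorem exists_relative_error {H n m ρ ε L : ℝ} (hH : 0 < H) (hm : 0 < m) (hρ : 0 < ρ)
    (hε : 0 < ε) (hn : 2 * H ^ 4 / (ρ ^ 2 * m ^ 2 * ε ^ 2) * L ≤ n) (hn₀ : L / m ^ 2 ≤ n) :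
    ∃ c, 0 ≤ c ∧ c ^ 2 ≤ 1 / 2 ∧ 2 * c / ρ * H ^ 2 ≤ ε ∧ L ≤ 2 * n * (c * m) ^ 2 := by
  have hsqrt : √(1 / 2 : ℝ) ^ 2 = 1 / 2 := Real.sq_sqrt (by norm_num)
  refine ⟨min (ρ * ε / (2 * H ^ 2)) √(1 / 2), by positivity, ?_, ?_, ?_⟩
  · calc min (ρ * ε / (2 * H ^ 2)) √(1 / 2) ^ 2 ≤ √(1 / 2) ^ 2 := by
          gcongr
          exact min_le_right _ _
      _ = 1 / 2 := hsqrt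
  · calc 2 * min (ρ * ε / (2 * H ^ 2)) √(1 / 2) / ρ * H ^ 2
        ≤ 2 * (ρ * ε / (2 * H ^ 2)) / ρ * H ^ 2 := by
          gcongr
          exact min_le_left _ _
      _ = ε := by field_simp
  · rcases min_choice (ρ * ε / (2 * H ^ 2)) √(1 / 2) with hmin | hmin <;> rw [hmin]
    · calc L = 2 * (2 * H ^ 4 / (ρ ^ 2 * m ^ 2 * ε ^ 2) * L) * (ρ * ε / (2 * H ^ 2) * m) ^ 2 := by
            field_simp
        _ ≤ 2 * n * (ρ * ε / (2 * H ^ 2) * m) ^ 2 := by gcongr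
    · calc L ≤ n * m ^ 2 := (div_le_iff₀ (by positivity)).1 hn₀
        _ = 2 * n * (√(1 / 2) * m) ^ 2 := by
          rw [mul_pow, hsqrt]
          ring

end SampleSize

end RobustMDP

open RobustMDP in
theorem theorem4_general {S A Ω : Type*} [Fintype S] [Nonempty S] [Fintype A] [Nonempty A]
    [MeasurableSpace S] [MeasurableSingletonClass S] [MeasurableSpace Ω]
    {μ : MeasureTheory.Measure Ω} [MeasureTheory.IsProbabilityMeasure μ] {H N : ℕ} (hH : 0 < H)
    (M : NominalMDP S A H) {X : Fin H → S → A → Fin N → Ω → S}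
    (hmeas : ∀ h s a i, Measurable (X h s a i))
    (hlaw : ∀ h s a i s', μ.real {ω | X h s a i ω = s'} = M.trans h s a s')
    (hindep : ∀ h s a, ProbabilityTheory.iIndepFun (X h s a) μ) {δ ρ ε : ℝ}
    (hδ : δ ∈ Set.Ioo (0 : ℝ) 1) (hρ : 0 < ρ) (hε : 0 < ε)
    (hN : 2 * (H : ℝ) ^ 5 * Fintype.card S * Fintype.card A / (ρ ^ 2 * M.pmin ^ 2 * ε ^ 2) *
        Real.log (2 * H * (Fintype.card S : ℝ) ^ 2 * Fintype.card A / δ) ≤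
      (N : ℝ) * Fintype.card S * Fintype.card A * H)
    (hN₀ : Real.log (2 * H * (Fintype.card S : ℝ) ^ 2 * Fintype.card A / δ) / M.pmin ^ 2 ≤
      (N : ℝ)) :
    1 - δ ≤ μ.real {ω | ∀ πhat ∈ rpvlOutputs ρ M.reward (empirical X ω),
      ‖M.optRobustValue ρ - M.robustValue ρ πhat‖ ≤ ε} := by
  set K : ℝ := 2 * H * (Fintype.card S : ℝ) ^ 2 * Fintype.card A with hK
  have hm : 0 < M.pmin := M.pmin_pos hH
  have hK₁ : 1 ≤ K := by
    rw [hK]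
    exact_mod_cast Nat.one_le_iff_ne_zero.2 (by positivity :
      2 * H * Fintype.card S ^ 2 * Fintype.card A ≠ 0)
  have hlog : 0 < Real.log (K / δ) := Real.log_pos ((one_lt_div hδ.1).2 (hδ.2.trans_le hK₁))
  have hN_ne : N ≠ 0 := by exact_mod_cast ((div_pos hlog (pow_pos hm 2)).trans_le hN₀).ne'
  have hN' : 2 * (H : ℝ) ^ 4 / (ρ ^ 2 * M.pmin ^ 2 * ε ^ 2) * Real.log (K / δ) ≤ N := by
    refine le_of_mul_le_mul_right ?_ (by positivity : (0 : ℝ) < Fintype.card S * Fintype.card A * H)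
    calc _ = _ := by ring
      _ ≤ _ := hN
      _ = _ := by ring
  obtain ⟨c, hc, hc', hcε, hcN⟩ :=
    exists_relative_error (Nat.cast_pos.2 hH) hm hρ hε hN' hN₀
  refine calc 1 - δ ≤ 1 - K * Real.exp (-(2 * N * (c * M.pmin) ^ 2)) :=
        sub_le_sub_left (mul_exp_neg_le_of_log_div_le (zero_lt_one.trans_le hK₁) hδ.1 hcN) 1
    _ ≤ μ.real {ω | ∀ h s a s',
          |empirical X ω h s a s' - M.trans h s a s'| ≤ c * M.trans h s a s'} :=
        one_sub_le_measureReal_forall_abs_empirical_sub_le hN_ne M hmeas hlaw hindep hc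
    _ ≤ _ := MeasureTheory.measureReal_mono ?_
  intro ω hω πhat hπhat
  have hratio := fun h s a s' =>
    le_exp_mul_of_abs_sub_le ((M.trans_mem h s a).1 s') hc hc' (hω h s a s')
  exact (M.norm_optRobustValue_sub_robustValue_le hρ (by positivity)
    (fun h s a => frequency_mem_stdSimplex hN_ne (X h s a) ω)
    (fun h s a s' => (hratio h s a s').1) (fun h s a s' => (hratio h s a s').2) hπhat).trans hcε

theorem theorem4 {S A Ω : Type*} [Fintype S] [Nonempty S] [Fintype A] [Nonempty A]
    [MeasurableSpace S] [MeasurableSingletonClass S] [MeasurableSpace Ω]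
    (μ : MeasureTheory.Measure Ω) [MeasureTheory.IsProbabilityMeasure μ]
    {H N : ℕ} (M : RobustMDP.NominalMDP S A H)
    (X : Fin H → S → A → Fin N → Ω → S) (hX : RobustMDP.IsGenerativeSample M μ X)
    (δ ρ ε : ℝ) (hδ : δ ∈ Set.Ioo (0 : ℝ) 1) (hρ : 0 < ρ) (hε : ε ∈ Set.Ioo (0 : ℝ) H)
    (hN : 2 * (H : ℝ) ^ 5 * Fintype.card S * Fintype.card A / (ρ ^ 2 * M.pmin ^ 2 * ε ^ 2) *
        Real.log (2 * H * (Fintype.card S : ℝ) ^ 2 * Fintype.card A / δ) ≤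
      (N : ℝ) * Fintype.card S * Fintype.card A * H)
    (hN₀ : Real.log (2 * H * (Fintype.card S : ℝ) ^ 2 * Fintype.card A / δ) / M.pmin ^ 2 ≤
      (N : ℝ)) :
    1 - δ ≤ μ.real {ω | ∀ πhat ∈ RobustMDP.rpvlOutputs ρ M.reward (RobustMDP.empirical X ω),
      ‖M.optRobustValue ρ - M.robustValue ρ πhat‖ ≤ ε} := by
  refine theorem4_general (by exact_mod_cast hε.1.trans hε.2) M hX.measurable hX.law
    (fun h s a => ?_) hδ hρ hε.1 hN hN₀
  exact hX.indep.precomp (g := fun i => (h, s, a, i)) fun _ _ => by simp
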